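/- Let $V$ be a finite set with $0 \notin V$, and let $\mathbb{S}^V$ be the space of real symmetric $V \times V$ matrices with the trace inner product $\langle X, Y\rangle = \operatorname{tr}(XY^{\mathsf T})$. Write $\mathrm{Diag}(h)$ for the diagonal matrix with diagonal $h \in \mathbb{R}^V$, $\operatorname{diag}(X)$ for the diagonal of a matrix $X$, and $\mathbb{S}^{\{0\}\cup V}_+$ for the cone of real symmetric positive semidefinite matrices indexed by $\{0\} \cup V$. For $\mathbb{A} \subseteq \mathbb{S}^V$ define $$\mathrm{TH}(\mathbb{A}) := \bigl\{ \operatorname{diag}(\hat X[V]) : \hat X \in \mathbb{S}^{\{0\}\cup V}_+,\ \hat X_{00} = 1,\ \hat X e_0 = \operatorname{diag}(\hat X),\ \hat X[V] \in \mathbb{A} \bigr\} \subseteq \mathbb{R}^V,$$ where $\hat X[V]$ is the principal submatrix of $\hat X$ indexed by $V$, and define $$\mathbb{A}^{\circledast} := \{\mathrm{Diag}(u) : u \in \mathbb{R}^V\} - \mathbb{A}^*, \qquad \mathbb{A}^* := \{ Y \in \mathbb{S}^V : \langle X, Y\rangle \ge 0 \text{ for all } X \in \mathbb{A} \}.$$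 For a convex set $C \subseteq \mathbb{R}^V$, a convex subset $F \subseteq C$ is a facet of $C$ if $\dim F = \dim C - 1$ and $F = \operatorname{argmax}_{x \in C} \langle c, x\rangle$ for some nonzero $c \in \mathbb{R}^V$; in this case $F$ is said to be determined by the inequality $\langle c, x\rangle \le \sup_{y \in C} \langle c, y\rangle$. (The inequality $x_i \ge 0$ is read as $\langle -e_i, x\rangle \le 0$.) **Theorem.** Let $\mathbb{A} \subseteq \mathbb{S}^V$ be a polyhedral cone (the solution set in $\mathbb{S}^V$ of finitely many homogeneous linear inequalities) such that $\mathrm{Diag}(h)\, X\, \mathrm{Diag}(h) \in \mathbb{A}$ for all $X \in \mathbb{A}$ and all $h \in \mathbb{R}^V$ with $h \ge 0$, and such that $\mathrm{Diag}(u) \in \mathbb{A}$ for all $u \in \mathbb{R}^V$. Then each facet of $\mathrm{TH}(\mathbb{A})$ is determined either by $x_i \ge 0$ for some $i \in V$, or by $\langle w, x\rangle \le 1$ for some $w \in \mathrm{TH}(\mathbb{A}^{\circledast}) \cap \{0,1\}^V$. -/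

import Mathlib

noncomputable section

namespace ThetaBody

variable {V : Type*}

/-- The trace inner product `⟨X, Y⟩ = tr (X Yᵀ)`. -/
def traceInner [Fintype V] (X Y : Matrix V V ℝ) : ℝ := (X * Y.transpose).trace

/-- `A` is a polyhedral cone in the space of symmetric `V × V` matrices: the set of all
symmetric matrices that satisfy finitely many homogeneous linear inequalities `⟨C, X⟩ ≥ 0`. -/
def IsPolyhedralSymCone [Fintype V] (A : Set (Matrix V V ℝ)) : Prop :=
  ∃ S : Finset (Matrix V V ℝ), A = {X | X.IsSymm ∧ ∀ C ∈ S, 0 ≤ traceInner C X}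

/-- `Diag(h) X Diag(h) ∈ A` for all `X ∈ A` and all nonnegative vectors `h`. -/
def IsDiagScalingInvariant [Fintype V] [DecidableEq V] (A : Set (Matrix V V ℝ)) : Prop :=
  ∀ h : V → ℝ, (∀ i, 0 ≤ h i) →
    ∀ X ∈ A, Matrix.diagonal h * X * Matrix.diagonal h ∈ A

/-- The dual cone of `A`, in the space of symmetric matrices with the trace inner product. -/
def dualCone [Fintype V] (A : Set (Matrix V V ℝ)) : Set (Matrix V V ℝ) :=
  {Y | Y.IsSymm ∧ ∀ X ∈ A, 0 ≤ traceInner X Y}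

/-- The special dual `Im(Diag) - A*`, where `A*` is the dual cone of `A`. -/
def adjDual [Fintype V] [DecidableEq V] (A : Set (Matrix V V ℝ)) : Set (Matrix V V ℝ) :=
  {X | ∃ u : V → ℝ, ∃ B ∈ dualCone A, X = Matrix.diagonal u - B}

/-- The cone of (symmetric) positive semidefinite real `W × W` matrices. -/
def psdCone (W : Type*) : Set (Matrix W W ℝ) := {X | X.PosSemidef}

/-- The lifted theta body. The index set `{0} ∪ V` is `Option V`, with `none` as `0`; the
conditions are `X₀₀ = 1`, `X e₀ = diag(X)` and `X[V] ∈ A`. -/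
def liftedTH [Fintype V] [DecidableEq V] (A : Set (Matrix V V ℝ))
    (K : Set (Matrix (Option V) (Option V) ℝ)) : Set (Matrix (Option V) (Option V) ℝ) :=
  {X | X ∈ K ∧ X none none = 1 ∧
    X.mulVec (Pi.single none 1) = X.diag ∧ X.submatrix some some ∈ A}

/-- The theta body `TH(A, K)`: all vectors `diag(X[V])` for `X` in the lifted theta body. -/
def TH [Fintype V] [DecidableEq V] (A : Set (Matrix V V ℝ))
    (K : Set (Matrix (Option V) (Option V) ℝ)) : Set (V → ℝ) :=
  {x | ∃ X ∈ liftedTH A K, x = (X.submatrix some some).diag}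

/-- The set of maximizers over `C` of the linear function `x ↦ ⟨c, x⟩`. -/
def argmax [Fintype V] (C : Set (V → ℝ)) (c : V → ℝ) : Set (V → ℝ) :=
  {x | x ∈ C ∧ ∀ y ∈ C, dotProduct c y ≤ dotProduct c x}

open Classical in
/-- The dimension of the affine hull, with the convention that the empty set has dimension `-1`. -/
def affDim (S : Set (V → ℝ)) : ℤ :=
  if S.Nonempty then (Module.finrank ℝ (vectorSpan ℝ S) : ℤ) else -1

/-- `F` is a facet of `C`: a convex subset of dimension one less than that of `C` which is the
set of maximizers over `C` of some nonzero linear function. -/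
def IsFacet [Fintype V] (C F : Set (V → ℝ)) : Prop :=
  Convex ℝ F ∧ F ⊆ C ∧ affDim F = affDim C - 1 ∧ ∃ c : V → ℝ, c ≠ 0 ∧ F = argmax C c

/-- The set `F` is determined, as a face of `C`, by the inequality `⟨c, x⟩ ≤ β`: the vector `c` is
nonzero, `β` is the value at `c` of the support function of `C`, and `F` is the set of
maximizers of `⟨c, x⟩` over `C`. -/
def IsDeterminedBy [Fintype V] (C F : Set (V → ℝ)) (c : V → ℝ) (β : ℝ) : Prop :=
  c ≠ 0 ∧ IsLUB {t | ∃ x ∈ C, t = dotProduct c x} β ∧ F = argmax C c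

end ThetaBody

end

namespace ThetaBody

open Matrix

variable {V : Type*}

/-! The theta body contains 0 and all unit vectors, hence is full-dimensional, and zeroing a
coordinate stays inside it. If a facet normal has a negative entry `c i`, every maximizer therefore
has `x i = 0`. Otherwise the maximum is positive and scales to 1, giving a normal `w`.

Conic duality (`exists_certificate`) certifies `⟨w, x⟩ ≤ 1` by a positive semidefinite `Z`. By
complementary slackness `Z` annihilates every lift of a facet point, so each row of `Z` is an affine
equation valid on the facet. The facet spans its hyperplane, which forces `Z` to be the rank-one
matrix of `(1, -w)`. The certificate then says that `Diag(w) - w wᵀ` lies in `A*`. As `A` contains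
all diagonal matrices, this matrix has zero diagonal, so `w` is 0-1, and `w wᵀ` lies in the special
dual. -/

theorem traceInner_eq_sum [Fintype V] (X Y : Matrix V V ℝ) :
    traceInner X Y = ∑ i, ∑ j, X i j * Y i j := by
  simp [traceInner, Matrix.trace, Matrix.mul_apply]

theorem traceInner_add_right [Fintype V] (X Y Z : Matrix V V ℝ) :
    traceInner X (Y + Z) = traceInner X Y + traceInner X Z := by
  simp [traceInner_eq_sum, mul_add, Finset.sum_add_distrib]

theorem traceInner_smul_right [Fintype V] (r : ℝ) (X Y : Matrix V V ℝ) :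
    traceInner X (r • Y) = r * traceInner X Y := by
  simp [traceInner_eq_sum, Finset.mul_sum, mul_left_comm]

theorem IsPolyhedralSymCone.isSymm [Fintype V] {A : Set (Matrix V V ℝ)}
    (hA : IsPolyhedralSymCone A) {X : Matrix V V ℝ} (hX : X ∈ A) : X.IsSymm := by
  obtain ⟨S, rfl⟩ := hA
  exact hX.1

theorem IsPolyhedralSymCone.add_mem [Fintype V] {A : Set (Matrix V V ℝ)}
    (hA : IsPolyhedralSymCone A) {X Y : Matrix V V ℝ} (hX : X ∈ A) (hY : Y ∈ A) : X + Y ∈ A := by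
  obtain ⟨S, rfl⟩ := hA
  refine ⟨hX.1.add hY.1, fun C hC => ?_⟩
  rw [traceInner_add_right]
  exact add_nonneg (hX.2 C hC) (hY.2 C hC)

theorem IsPolyhedralSymCone.smul_mem [Fintype V] {A : Set (Matrix V V ℝ)}
    (hA : IsPolyhedralSymCone A) {r : ℝ} (hr : 0 ≤ r) {X : Matrix V V ℝ} (hX : X ∈ A) :
    r • X ∈ A := by
  obtain ⟨S, rfl⟩ := hA
  refine ⟨hX.1.smul r, fun C hC => ?_⟩
  rw [traceInner_smul_right]
  exact mul_nonneg hr (hX.2 C hC)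

/-! ### Positive semidefinite and positive definite matrices. -/

/-- Positive semidefinite matrices whose product has nonpositive trace annihilate each other. -/
theorem mul_eq_zero_of_trace_nonpos {W : Type*} [Fintype W] [DecidableEq W]
    {Z X : Matrix W W ℝ} (hZ : Z.PosSemidef) (hX : X.PosSemidef) (h : (Z * X).trace ≤ 0) :
    Z * X = 0 := by
  open scoped MatrixOrder in
  obtain ⟨C, rfl⟩ := CStarAlgebra.nonneg_iff_eq_star_mul_self.mp hZ.nonneg
  obtain ⟨B, rfl⟩ := CStarAlgebra.nonneg_iff_eq_star_mul_self.mp hX.nonneg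
  simp only [star_eq_conjTranspose] at *
  -- The trace of `Z X` is the squared Frobenius norm of `C * Bᴴ`.
  have hP : ((C * Bᴴ)ᴴ * (C * Bᴴ)).PosSemidef := posSemidef_conjTranspose_mul_self _
  have htr : ((C * Bᴴ)ᴴ * (C * Bᴴ)).trace = (Cᴴ * C * (Bᴴ * B)).trace := by
    rw [conjTranspose_mul, conjTranspose_conjTranspose, ← Matrix.mul_assoc (Cᴴ * C) Bᴴ B,
      Matrix.trace_mul_comm _ B]
    simp only [Matrix.mul_assoc]
  have h0 : (C * Bᴴ)ᴴ * (C * Bᴴ) = 0 :=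
    hP.trace_eq_zero_iff.mp (le_antisymm (htr ▸ h) hP.trace_nonneg)
  rw [conjTranspose_mul_self_eq_zero] at h0
  rw [Matrix.mul_assoc, ← Matrix.mul_assoc C, h0]
  simp

/-- The matrices with positive definite symmetric part form an open set. -/
theorem isOpen_forall_dotProduct_mulVec_pos {W : Type*} [Fintype W] :
    IsOpen {X : Matrix W W ℝ | ∀ v : W → ℝ, v ≠ 0 → 0 < v ⬝ᵥ (X *ᵥ v)} := by
  -- By homogeneity the unit sphere suffices, and it is compact.
  have heq : {X : Matrix W W ℝ | ∀ v : W → ℝ, v ≠ 0 → 0 < v ⬝ᵥ (X *ᵥ v)} =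
      {X | ∀ v ∈ Metric.sphere (0 : W → ℝ) 1, 0 < v ⬝ᵥ (X *ᵥ v)} := by
    ext X
    refine ⟨fun h v hv => h v ?_, fun h v hv => ?_⟩
    · rintro rfl
      simp at hv
    · have hn : 0 < ‖v‖ := norm_pos_iff.mpr hv
      have := h (‖v‖⁻¹ • v) (by simp [norm_smul, hn.ne'])
      rw [mulVec_smul, smul_dotProduct, dotProduct_smul, smul_eq_mul, smul_eq_mul] at this
      exact pos_of_mul_pos_right (pos_of_mul_pos_right this (by positivity)) (by positivity)
  rw [heq, isOpen_iff_eventually]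
  intro X hX
  refine (isCompact_sphere (0 : W → ℝ) 1).eventually_forall_of_forall_eventually fun v hv => ?_
  have hc : Continuous fun p : Matrix W W ℝ × (W → ℝ) => p.2 ⬝ᵥ (p.1 *ᵥ p.2) := by fun_prop
  exact hc.continuousAt.eventually_const_lt (hX v hv)

/-! ### Points, dimension and spanning hyperplanes of the theta body. -/

theorem mem_TH [Fintype V] [DecidableEq V] {A : Set (Matrix V V ℝ)} {x : V → ℝ} :
    x ∈ TH A (psdCone (Option V)) ↔ ∃ X : Matrix (Option V) (Option V) ℝ, X.PosSemidef ∧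
      X none none = 1 ∧ (∀ i, X (some i) none = x i) ∧ (∀ i, X (some i) (some i) = x i) ∧
      X.submatrix some some ∈ A := by
  constructor
  · rintro ⟨X, ⟨hX, h1, h2, h3⟩, rfl⟩
    refine ⟨X, hX, h1, fun i => ?_, fun i => rfl, h3⟩
    have := congrFun h2 (some i)
    simpa [mulVec_single_one] using this
  · rintro ⟨X, hX, h1, h2, h3, h4⟩
    refine ⟨X, ⟨hX, h1, ?_, h4⟩, ?_⟩
    · ext o
      cases o <;> simp [h1, h2, h3]
    · ext i
      simp [h3]

/-- The lift is the rank-one matrix of `(1, w)`; idempotent entries make its border equal its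
diagonal. -/
theorem outer_mem_TH [Fintype V] [DecidableEq V] {A : Set (Matrix V V ℝ)} {w : V → ℝ}
    (hw : ∀ i, w i * w i = w i) (hA : vecMulVec w w ∈ A) : w ∈ TH A (psdCone (Option V)) := by
  refine mem_TH.mpr ⟨vecMulVec (fun o => o.elim 1 w) (fun o => o.elim 1 w), ?_, ?_, ?_, ?_, ?_⟩
  · simpa using posSemidef_vecMulVec_self_star (R := ℝ) (fun o : Option V => o.elim 1 w)
  · simp [vecMulVec_apply]
  · simp [vecMulVec_apply]
  · simp [vecMulVec_apply, hw]
  · exact hA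

theorem zero_mem_TH [Fintype V] [DecidableEq V] {A : Set (Matrix V V ℝ)}
    (hdiag : ∀ u, diagonal u ∈ A) : (0 : V → ℝ) ∈ TH A (psdCone (Option V)) := by
  refine outer_mem_TH (by simp) ?_
  simpa using hdiag 0

theorem single_mem_TH [Fintype V] [DecidableEq V] {A : Set (Matrix V V ℝ)}
    (hdiag : ∀ u, diagonal u ∈ A) (i : V) :
    (Pi.single i 1 : V → ℝ) ∈ TH A (psdCone (Option V)) := by
  refine outer_mem_TH (fun j => ?_) ?_
  · rcases eq_or_ne j i with rfl | h <;> simp [*]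
  · convert hdiag (Pi.single i 1) using 1
    ext j k
    rcases eq_or_ne j k with rfl | h
    · rcases eq_or_ne j i with rfl | h' <;> simp [vecMulVec_apply, *]
    · rcases eq_or_ne j i with rfl | h'
      · simp [vecMulVec_apply, h, h.symm]
      · simp [vecMulVec_apply, h, h']

theorem nonneg_of_mem_TH [Fintype V] [DecidableEq V] {A : Set (Matrix V V ℝ)} {x : V → ℝ}
    (hx : x ∈ TH A (psdCone (Option V))) (i : V) : 0 ≤ x i := by
  obtain ⟨X, hX, -, -, h, -⟩ := mem_TH.mp hx
  exact h i ▸ hX.diag_nonneg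

/-- Congruence of the lift by a 0-1 diagonal matrix keeps the border equal to the diagonal. -/
theorem update_zero_mem_TH [Fintype V] [DecidableEq V] {A : Set (Matrix V V ℝ)}
    (hscal : IsDiagScalingInvariant A) {x : V → ℝ}
    (hx : x ∈ TH A (psdCone (Option V))) (i : V) :
    Function.update x i 0 ∈ TH A (psdCone (Option V)) := by
  obtain ⟨X, hX, h1, h2, h3, h4⟩ := mem_TH.mp hx
  let h : V → ℝ := fun j => if j = i then 0 else 1
  let D : Matrix (Option V) (Option V) ℝ := diagonal fun o => o.elim 1 h
  refine mem_TH.mpr ⟨D * X * D, ?_, ?_, fun j => ?_, fun j => ?_, ?_⟩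
  · simpa [D] using hX.mul_mul_conjTranspose_same D
  · simp [D, h1]
  · rcases eq_or_ne j i with rfl | hj <;> simp [D, h, *]
  · rcases eq_or_ne j i with rfl | hj <;> simp [D, h, *]
  · convert hscal h (fun j => by by_cases hj : j = i <;> simp [h, hj]) _ h4 using 1
    ext j k
    simp [D]

theorem affDim_TH [Fintype V] [DecidableEq V] {A : Set (Matrix V V ℝ)}
    (hdiag : ∀ u, diagonal u ∈ A) :
    affDim (TH A (psdCone (Option V))) = Fintype.card V := by
  have h0 := zero_mem_TH hdiag
  have htop : vectorSpan ℝ (TH A (psdCone (Option V))) = ⊤ := by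
    rw [eq_top_iff, ← (Pi.basisFun ℝ V).span_eq, Submodule.span_le]
    rintro _ ⟨i, rfl⟩
    have := vsub_mem_vectorSpan ℝ (single_mem_TH hdiag i) h0
    simpa using this
  rw [affDim, if_pos ⟨0, h0⟩, htop, finrank_top, Module.finrank_fintype_fun_eq_card]

/-- A set of codimension one inside a hyperplane `⟨c, x⟩ = β` spans it affinely: every affine
equation valid on the set is a multiple of that of the hyperplane. -/
theorem exists_eq_smul_of_affDim [Fintype V] [DecidableEq V] {F : Set (V → ℝ)} {c a : V → ℝ}
    {β b : ℝ} (hF : F.Nonempty) (hdim : affDim F = Fintype.card V - 1) (hc : c ≠ 0)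
    (hcF : ∀ x ∈ F, c ⬝ᵥ x = β) (haF : ∀ x ∈ F, a ⬝ᵥ x = b) :
    ∃ r : ℝ, a = r • c ∧ b = r * β := by
  let φ : (V → ℝ) → (V → ℝ) →ₗ[ℝ] ℝ := fun d => dotProductBilin ℝ ℝ d
  have hle : ∀ (d : V → ℝ) (δ : ℝ), (∀ x ∈ F, d ⬝ᵥ x = δ) → vectorSpan ℝ F ≤ (φ d).ker := by
    intro d δ hd
    rw [vectorSpan_def, Submodule.span_le]
    rintro _ ⟨x, hx, y, hy, rfl⟩
    simp [φ, dotProduct_sub, hd x hx, hd y hy]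
  have hcc : c ⬝ᵥ c ≠ 0 := by simpa using hc
  have hrange : (φ c).range = ⊤ := by
    rw [LinearMap.range_eq_top]
    exact LinearMap.surjective fun h => hcc (by simpa [φ] using LinearMap.congr_fun h c)
  have hrn := (φ c).finrank_range_add_finrank_ker
  rw [hrange, finrank_top, Module.finrank_self, Module.finrank_fintype_fun_eq_card] at hrn
  rw [affDim, if_pos hF] at hdim
  have hker : vectorSpan ℝ F = (φ c).ker :=
    Submodule.eq_of_le_of_finrank_eq (hle c β hcF) (by omega)
  -- Split `x` into a multiple of `c` and a vector of the kernel, on which `a` vanishes.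
  have ha : ∀ x : V → ℝ, a ⬝ᵥ x = (a ⬝ᵥ c / c ⬝ᵥ c) * (c ⬝ᵥ x) := by
    intro x
    have hx : x - (c ⬝ᵥ x / c ⬝ᵥ c) • c ∈ (φ c).ker := by
      simp [φ, dotProduct_sub, hcc]
    have := hle a b haF (hker ▸ hx)
    simp [φ, dotProduct_sub] at this
    rw [sub_eq_zero.mp this]
    ring
  refine ⟨a ⬝ᵥ c / c ⬝ᵥ c, ?_, ?_⟩
  · ext i
    simpa using ha (Pi.single i 1)
  · obtain ⟨p, hp⟩ := hF
    rw [← haF p hp, ← hcF p hp, ha p]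

/-! ### Bordered matrices and conic duality. -/

/-- The symmetric matrix with corner `t` and block `X` whose border is the diagonal of `X`. -/
def bordered (t : ℝ) (X : Matrix V V ℝ) : Matrix (Option V) (Option V) ℝ :=
  Matrix.of fun
    | none, none => t
    | none, some i => X i i
    | some i, none => X i i
    | some i, some j => X i j

theorem bordered_isSymm {t : ℝ} {X : Matrix V V ℝ} (hX : X.IsSymm) : (bordered t X).IsSymm := by
  ext o p
  cases o <;> cases p <;> simp [bordered, hX.apply]

/-- A linear functional on square matrices is, on symmetric matrices, the pairing with a symmetric
matrix. -/
theorem exists_isSymm_apply_eq_sum {W : Type*} [Fintype W] [DecidableEq W]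
    (ψ : Matrix W W ℝ →ₗ[ℝ] ℝ) :
    ∃ Z : Matrix W W ℝ, Z.IsSymm ∧
      ∀ X : Matrix W W ℝ, X.IsSymm → ψ X = ∑ i, ∑ j, Z i j * X i j := by
  refine ⟨Matrix.of fun i j => (ψ (single i j 1) + ψ (single j i 1)) / 2, ?_, fun X hX => ?_⟩
  · ext i j
    simp [add_comm]
  have h : ψ X = ∑ i, ∑ j, ψ (single i j 1) * X i j := by
    conv_lhs => rw [matrix_eq_sum_single X]
    simp only [map_sum]
    refine Finset.sum_congr rfl fun i _ => Finset.sum_congr rfl fun j _ => ?_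
    rw [← mul_one (X i j), ← smul_eq_mul (X i j), ← smul_single, map_smul, smul_eq_mul,
      smul_eq_mul, mul_one, mul_comm]
  have h' : ψ X = ∑ i, ∑ j, ψ (single j i 1) * X i j := by
    rw [h, Finset.sum_comm]
    simp only [hX.apply]
  simp only [of_apply, add_div, add_mul, Finset.sum_add_distrib]
  simp only [div_mul_eq_mul_div, ← Finset.sum_div]
  rw [← h, ← h']
  ring

/-- A functional that is nonnegative on the positive definite matrices is given by a positive
semidefinite matrix. -/
theorem exists_posSemidef_apply_eq_sum {W : Type*} [Fintype W] [DecidableEq W]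
    (ψ : Matrix W W ℝ →ₗ[ℝ] ℝ)
    (hψ : ∀ X : Matrix W W ℝ, (∀ v : W → ℝ, v ≠ 0 → 0 < v ⬝ᵥ (X *ᵥ v)) → 0 ≤ ψ X) :
    ∃ Z : Matrix W W ℝ, Z.PosSemidef ∧
      ∀ X : Matrix W W ℝ, X.IsSymm → ψ X = ∑ i, ∑ j, Z i j * X i j := by
  obtain ⟨Z, hZ, hZψ⟩ := exists_isSymm_apply_eq_sum ψ
  refine ⟨Z, PosSemidef.of_dotProduct_mulVec_nonneg (by
    rw [IsHermitian, conjTranspose_eq_transpose_of_trivial]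
    exact hZ)
    fun v => ?_,
    hZψ⟩
  have hone : ∀ u : W → ℝ, u ≠ 0 → 0 < u ⬝ᵥ u := fun u hu => by
    simpa using dotProduct_star_self_pos_iff.mpr hu
  have hψ1 : 0 ≤ ψ 1 := hψ 1 fun u hu => by simpa using hone u hu
  have hv : star v ⬝ᵥ (Z *ᵥ v) = ψ (vecMulVec v v) := by
    rw [hZψ _ (by ext i j; simp [vecMulVec_apply, mul_comm])]
    simp only [star_trivial, dotProduct, mulVec, vecMulVec_apply, Finset.mul_sum]
    refine Finset.sum_congr rfl fun i _ => Finset.sum_congr rfl fun j _ => by ring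
  rw [hv]
  refine le_of_forall_pos_le_add fun δ hδ => ?_
  -- The matrix `v vᵀ` is only semidefinite; a small multiple of the identity makes it definite, at
  -- a cost of at most `δ`.
  have hε : 0 < δ / (ψ 1 + 1) := by positivity
  have := hψ (vecMulVec v v + (δ / (ψ 1 + 1)) • 1) fun u hu => by
    rw [add_mulVec, dotProduct_add, smul_mulVec, one_mulVec, dotProduct_smul, smul_eq_mul]
    refine add_pos_of_nonneg_of_pos ?_ (mul_pos hε (hone u hu))
    simpa using (posSemidef_vecMulVec_self_star (R := ℝ) v).dotProduct_mulVec_nonneg u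
  rw [map_add, map_smul, smul_eq_mul] at this
  have hle : δ / (ψ 1 + 1) * ψ 1 ≤ δ := by
    rw [div_mul_eq_mul_div, div_le_iff₀ (by positivity)]
    nlinarith
  linarith

/-- The matrices with positive definite symmetric part form a convex set. -/
theorem convex_forall_dotProduct_mulVec_pos {W : Type*} [Fintype W] :
    Convex ℝ {X : Matrix W W ℝ | ∀ v : W → ℝ, v ≠ 0 → 0 < v ⬝ᵥ (X *ᵥ v)} := by
  intro X hX Y hY a b ha hb hab v hv
  rw [add_mulVec, dotProduct_add, smul_mulVec, smul_mulVec, dotProduct_smul, dotProduct_smul,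
    smul_eq_mul, smul_eq_mul]
  have h1 := hX v hv
  have h2 := hY v hv
  rcases ha.eq_or_lt with rfl | ha
  · rw [zero_add] at hab
    simpa [hab] using h2
  · positivity

/-- Fenchel duality for cones: if the linear functional `l` is nonnegative on `P ∩ K`, where `P` is
a convex cone that meets the open convex set `K`, then `l` dominates on `P` a linear functional
that is nonnegative on `K`. -/
theorem exists_linearMap_nonneg_le {E : Type*} [AddCommGroup E] [Module ℝ E] [TopologicalSpace E]
    [IsTopologicalAddGroup E] [ContinuousSMul ℝ E] {K P : Set E} (hK : Convex ℝ K) (hKo : IsOpen K)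
    (hadd : ∀ X ∈ P, ∀ Y ∈ P, X + Y ∈ P) (hsmul : ∀ r : ℝ, 0 ≤ r → ∀ X ∈ P, r • X ∈ P)
    {S : E} (hSP : S ∈ P) (hS : S ∈ K) (l : E →ₗ[ℝ] ℝ) (hl : ∀ X ∈ P, X ∈ K → 0 ≤ l X) :
    ∃ ψ : E →ₗ[ℝ] ℝ, (∀ X ∈ K, 0 ≤ ψ X) ∧ ∀ X ∈ P, ψ X ≤ l X := by
  -- The epigraph of `l` over `P` is separated from `K × (-∞, 0)`.
  have hTconv : Convex ℝ {p : E × ℝ | p.1 ∈ P ∧ l p.1 ≤ p.2} := by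
    rintro ⟨X, s⟩ ⟨hX, hs⟩ ⟨Y, t⟩ ⟨hY, ht⟩ a b ha hb hab
    refine ⟨hadd _ (hsmul a ha X hX) _ (hsmul b hb Y hY), ?_⟩
    change l (a • X + b • Y) ≤ a * s + b * t
    rw [map_add, map_smul, map_smul, smul_eq_mul, smul_eq_mul]
    exact add_le_add (mul_le_mul_of_nonneg_left hs ha) (mul_le_mul_of_nonneg_left ht hb)
  have hdisj : Disjoint (K ×ˢ Set.Iio (0 : ℝ)) {p : E × ℝ | p.1 ∈ P ∧ l p.1 ≤ p.2} := by
    rw [Set.disjoint_left]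
    rintro ⟨X, t⟩ ⟨hX, ht⟩ ⟨hXP, hlt⟩
    exact absurd ((hl X hXP hX).trans hlt) (not_le.mpr ht)
  obtain ⟨f, a, hf1, hf2⟩ := geometric_hahn_banach_open (hK.prod (convex_Iio 0))
    (hKo.prod isOpen_Iio) hTconv hdisj
  obtain ⟨φ, τ, hf⟩ : ∃ (φ : E →ₗ[ℝ] ℝ) (τ : ℝ), ∀ X t, f (X, t) = φ X + t * τ := by
    refine ⟨f.toLinearMap ∘ₗ LinearMap.inl ℝ _ _, f (0, 1), fun X t => ?_⟩
    have : ((X, t) : E × ℝ) = (X, 0) + t • (0, 1) := by simp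
    rw [this, map_add, map_smul, smul_eq_mul]
    rfl
  have ha0 : a ≤ 0 := by
    have h0 : (0 : E) ∈ P := by simpa using hsmul 0 le_rfl S hSP
    simpa [hf] using hf2 (0, 0) ⟨h0, by simp⟩
  have hneg : ∀ X ∈ K, ∀ t < 0, φ X + t * τ < 0 := by
    intro X hX t ht
    rw [← hf]
    exact (hf1 (X, t) ⟨hX, ht⟩).trans_le ha0
  have hpos : ∀ X ∈ P, 0 ≤ φ X + l X * τ := by
    intro X hX
    by_contra! h
    have h2 : ∀ r : ℝ, 0 ≤ r → a ≤ r * (φ X + l X * τ) := by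
      intro r hr
      have := hf2 (r • X, l (r • X)) ⟨hsmul r hr X hX, le_rfl⟩
      rw [hf, map_smul, map_smul, smul_eq_mul, smul_eq_mul] at this
      linarith
    -- This multiple gives the value `a - 1`, below the bound `a`.
    have := h2 ((a - 1) / (φ X + l X * τ)) (div_nonneg_of_nonpos (by linarith) h.le)
    rw [div_mul_cancel₀ _ h.ne] at this
    linarith
  have hφK : ∀ X ∈ K, φ X ≤ 0 := by
    intro X hX
    refine le_of_forall_pos_le_add fun δ hδ => ?_
    have hε : 0 < δ / (|τ| + 1) := by positivity
    have h1 := hneg X hX (-(δ / (|τ| + 1))) (by linarith)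
    have h2 : δ / (|τ| + 1) * τ ≤ δ := by
      rw [div_mul_eq_mul_div, div_le_iff₀ (by positivity)]
      nlinarith [le_abs_self τ]
    linarith
  -- The Slater point excludes a vertical hyperplane: if `τ ≤ 0`, then `hpos` gives `φ S ≥ 0`, but
  -- `hneg` at `t = -1` gives `φ S < τ`.
  have hτ : 0 < τ := by
    have h1 := hpos S hSP
    have h2 := hφK S hS
    have h3 := hneg S hS (-(l S) - 1) (by linarith [hl S hSP hS])
    have h4 := hneg S hS (-1) (by norm_num)
    have hlS := hl S hSP hS
    by_contra! h
    nlinarith [mul_nonneg hlS (neg_nonneg.mpr h)]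
  refine ⟨-(τ⁻¹ • φ), fun X hX => ?_, fun X hX => ?_⟩
  · simpa using mul_nonneg (inv_nonneg.mpr hτ.le) (neg_nonneg.mpr (hφK X hX))
  · have := mul_nonneg (inv_nonneg.mpr hτ.le) (hpos X hX)
    rw [mul_add, mul_comm (l X), inv_mul_cancel_left₀ hτ.ne'] at this
    simp only [LinearMap.neg_apply, LinearMap.smul_apply, smul_eq_mul]
    linarith

/-- Conic duality under Slater's condition: if `ℓ` is nonnegative on the positive definite members
of the convex cone `P` of symmetric matrices, and there is one, then `ℓ` dominates on `P` the
pairing with some positive semidefinite matrix. -/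
theorem exists_posSemidef_sum_le {W : Type*} [Fintype W] [DecidableEq W]
    {P : Set (Matrix W W ℝ)} (hsymm : ∀ X ∈ P, X.IsSymm)
    (hadd : ∀ X ∈ P, ∀ Y ∈ P, X + Y ∈ P) (hsmul : ∀ r : ℝ, 0 ≤ r → ∀ X ∈ P, r • X ∈ P)
    {S : Matrix W W ℝ} (hSP : S ∈ P) (hS : ∀ v : W → ℝ, v ≠ 0 → 0 < v ⬝ᵥ (S *ᵥ v))
    (l : Matrix W W ℝ →ₗ[ℝ] ℝ)
    (hl : ∀ X ∈ P, (∀ v : W → ℝ, v ≠ 0 → 0 < v ⬝ᵥ (X *ᵥ v)) → 0 ≤ l X) :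
    ∃ Z : Matrix W W ℝ, Z.PosSemidef ∧ ∀ X ∈ P, ∑ i, ∑ j, Z i j * X i j ≤ l X := by
  obtain ⟨ψ, hψK, hψP⟩ := exists_linearMap_nonneg_le convex_forall_dotProduct_mulVec_pos
    isOpen_forall_dotProduct_mulVec_pos hadd hsmul hSP hS l hl
  obtain ⟨Z, hZ, hZψ⟩ := exists_posSemidef_apply_eq_sum ψ hψK
  exact ⟨Z, hZ, fun X hX => hZψ X (hsymm X hX) ▸ hψP X hX⟩

/-- Supplies the Slater point for `exists_certificate`; the proof completes squares. -/
theorem bordered_diagonal_pos [Fintype V] [DecidableEq V] {ε : ℝ} (hε : 0 < ε)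
    (hεV : ε * Fintype.card V < 1) {v : Option V → ℝ} (hv : v ≠ 0) :
    0 < v ⬝ᵥ (bordered 1 (diagonal fun _ : V => ε) *ᵥ v) := by
  have h : v ⬝ᵥ (bordered 1 (diagonal fun _ : V => ε) *ᵥ v) =
      (1 - ε * Fintype.card V) * v none ^ 2 + ∑ i, ε * (v (some i) + v none) ^ 2 := by
    have h1 : ∀ i : V, (∑ j, diagonal (fun _ : V => ε) i j * v (some j)) = ε * v (some i) :=
      fun i => mulVec_diagonal (fun _ : V => ε) (fun j => v (some j)) i
    simp only [dotProduct, mulVec, Fintype.sum_option, bordered, of_apply, diagonal_apply_eq, h1]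
    have h2 : ∑ i : V, ε * (v (some i) + v none) ^ 2 = ε * ∑ i, v (some i) ^ 2 +
        2 * (ε * v none * ∑ i, v (some i)) + Fintype.card V * (ε * v none ^ 2) := by
      rw [← smul_eq_mul (Fintype.card V : ℝ), Nat.cast_smul_eq_nsmul, ← Finset.card_univ,
        ← Finset.sum_const]
      simp only [Finset.mul_sum, ← Finset.sum_add_distrib]
      refine Finset.sum_congr rfl fun i _ => by ring
    have h3 : ∑ i : V, v (some i) * (ε * v none + ε * v (some i)) = ε * ∑ i, v (some i) ^ 2 +
        ε * v none * ∑ i, v (some i) := by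
      simp only [Finset.mul_sum, ← Finset.sum_add_distrib]
      refine Finset.sum_congr rfl fun i _ => by ring
    rw [h2, h3, ← Finset.mul_sum]
    ring
  rw [h]
  have hnn : 0 ≤ ∑ i, ε * (v (some i) + v none) ^ 2 := Finset.sum_nonneg fun i _ => by positivity
  rcases eq_or_ne (v none) 0 with h0 | h0
  · obtain ⟨o, ho⟩ := Function.ne_iff.mp hv
    cases o with
    | none => exact absurd h0 ho
    | some i =>
      have : 0 < ∑ i, ε * (v (some i) + v none) ^ 2 := by
        refine Finset.sum_pos' (fun i _ => by positivity) ⟨i, Finset.mem_univ i, ?_⟩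
        have : v (some i) ≠ 0 := ho
        rw [h0, add_zero]
        positivity
      simpa [h0] using this
  · have : 0 < (1 - ε * Fintype.card V) * v none ^ 2 := mul_pos (by linarith) (by positivity)
    linarith

/-! ### Certificates and the normals of facets. -/

/-- Every inequality `⟨w, x⟩ ≤ 1` valid for the theta body has a semidefinite certificate. -/
theorem exists_certificate [Fintype V] [DecidableEq V] {A : Set (Matrix V V ℝ)}
    (hpoly : IsPolyhedralSymCone A) (hdiag : ∀ u, diagonal u ∈ A) {w : V → ℝ}
    (hw : ∀ x ∈ TH A (psdCone (Option V)), w ⬝ᵥ x ≤ 1) :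
    ∃ Z : Matrix (Option V) (Option V) ℝ, Z.PosSemidef ∧ Z none none = 1 ∧ ∀ X ∈ A,
      ∑ i, (w i + 2 * Z (some i) none) * X i i + ∑ i, ∑ j, Z (some i) (some j) * X i j ≤ 0 := by
  let P : Set (Matrix (Option V) (Option V) ℝ) := {Y | ∃ t : ℝ, ∃ X ∈ A, Y = bordered t X}
  -- The homogenization of `1 - ⟨w, x⟩`.
  let l : Matrix (Option V) (Option V) ℝ →ₗ[ℝ] ℝ :=
    { toFun := fun Y => Y none none - ∑ i, w i * Y (some i) none
      map_add' := fun X Y => by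
        simp only [Matrix.add_apply, mul_add, Finset.sum_add_distrib]
        ring
      map_smul' := fun r X => by
        simp only [Matrix.smul_apply, smul_eq_mul, RingHom.id_apply, mul_sub, Finset.mul_sum,
          mul_left_comm] }
  have hε : (0 : ℝ) < 1 / (Fintype.card V + 1) := by positivity
  obtain ⟨Z, hZ, hZP⟩ := exists_posSemidef_sum_le (P := P)
    (by rintro _ ⟨t, X, hX, rfl⟩; exact bordered_isSymm (hpoly.isSymm hX))
    (by
      rintro _ ⟨s, X, hX, rfl⟩ _ ⟨t, Y, hY, rfl⟩
      refine ⟨s + t, X + Y, hpoly.add_mem hX hY, ?_⟩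
      ext o p
      cases o <;> cases p <;> simp [bordered])
    (by
      rintro r hr _ ⟨t, X, hX, rfl⟩
      refine ⟨r * t, r • X, hpoly.smul_mem hr hX, ?_⟩
      ext o p
      cases o <;> cases p <;> simp [bordered])
    ⟨1, _, hdiag fun _ => 1 / (Fintype.card V + 1), rfl⟩
    (fun v hv => bordered_diagonal_pos hε (by
      rw [div_mul_eq_mul_div, div_lt_one (by positivity)]
      linarith) hv) l
    (by
      rintro _ ⟨t, X, hX, rfl⟩ hpos
      have ht : 0 < t := by simpa [bordered] using hpos (Pi.single none 1) (by simp)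
      have hpsd : (bordered t X).PosSemidef :=
        PosSemidef.of_dotProduct_mulVec_nonneg
          (by
            rw [IsHermitian, conjTranspose_eq_transpose_of_trivial]
            exact bordered_isSymm (hpoly.isSymm hX)) fun v => by
            rcases eq_or_ne v 0 with rfl | hv
            · simp
            · exact (hpos v hv).le
      have hmem : t⁻¹ • X.diag ∈ TH A (psdCone (Option V)) := by
        refine mem_TH.mpr ⟨t⁻¹ • bordered t X, hpsd.smul (inv_nonneg.mpr ht.le), ?_, ?_, ?_, ?_⟩
        · simp [bordered, ht.ne']
        · simp [bordered]
        · simp [bordered]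
        · exact hpoly.smul_mem (inv_nonneg.mpr ht.le) hX
      have h1 := hw _ hmem
      rw [dotProduct_smul, smul_eq_mul, inv_mul_le_iff₀ ht, mul_one] at h1
      change 0 ≤ t - ∑ i, w i * X i i
      exact sub_nonneg.mpr h1)
  have hZs : ∀ i, Z none (some i) = Z (some i) none := fun i => by
    simpa using hZ.isHermitian.apply (some i) none
  have key : ∀ t : ℝ, ∀ X ∈ A, Z none none * t +
      (∑ i, (w i + 2 * Z (some i) none) * X i i + ∑ i, ∑ j, Z (some i) (some j) * X i j) ≤ t := by
    intro t X hX
    have := hZP (bordered t X) ⟨t, X, hX, rfl⟩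
    change _ ≤ t - ∑ i, w i * X i i at this
    simp only [Fintype.sum_option, bordered, of_apply, hZs, Finset.sum_add_distrib] at this
    have h2 : ∑ i, (w i + 2 * Z (some i) none) * X i i =
        ∑ i, w i * X i i + 2 * ∑ i, Z (some i) none * X i i := by
      rw [Finset.mul_sum, ← Finset.sum_add_distrib]
      exact Finset.sum_congr rfl fun i _ => by ring
    rw [h2]
    linarith
  have h0 : (0 : Matrix V V ℝ) ∈ A := by simpa using hdiag 0
  -- The corner is free in sign, so its two signs force `Z none none = 1`.
  have h1 := key 1 0 h0
  have h2 := key (-1) 0 h0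
  simp only [Matrix.zero_apply, mul_zero, Finset.sum_const_zero, add_zero] at h1 h2
  exact ⟨Z, hZ, by linarith, fun X hX => by simpa using key 0 X hX⟩

/-- If `Y ∈ A*` and `A` contains the diagonal matrices, then `Y` has zero diagonal. -/
theorem diag_eq_zero_of_forall_nonneg [Fintype V] [DecidableEq V] {A : Set (Matrix V V ℝ)}
    (hdiag : ∀ u, diagonal u ∈ A) {Y : Matrix V V ℝ}
    (hY : ∀ X ∈ A, 0 ≤ traceInner X Y) (i : V) : Y i i = 0 := by
  have h : ∀ r : ℝ, traceInner (diagonal (Pi.single i r)) Y = r * Y i i := by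
    intro r
    rw [traceInner, trace, Finset.sum_eq_single i]
    · simp
    · intro j _ hj
      simp [hj]
    · simp
  have h1 := hY _ (hdiag (Pi.single i 1))
  have h2 := hY _ (hdiag (Pi.single i (-1)))
  rw [h] at h1 h2
  linarith

/-- The facets of the theta body that lie on a hyperplane `⟨w, x⟩ = 1`, where `⟨w, x⟩ ≤ 1` is
valid, have a `0`-`1` normal vector in the theta body of the special dual. -/
theorem mem_TH_adjDual_of_facet [Fintype V] [DecidableEq V] {A : Set (Matrix V V ℝ)}
    (hpoly : IsPolyhedralSymCone A) (hdiag : ∀ u, diagonal u ∈ A) {w : V → ℝ} (hw0 : w ≠ 0)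
    (hw : ∀ x ∈ TH A (psdCone (Option V)), w ⬝ᵥ x ≤ 1) {F : Set (V → ℝ)}
    (hne : F.Nonempty) (hdim : affDim F = Fintype.card V - 1)
    (hF : F ⊆ TH A (psdCone (Option V))) (hwF : ∀ x ∈ F, w ⬝ᵥ x = 1) :
    w ∈ TH (adjDual A) (psdCone (Option V)) ∧ ∀ i, w i = 0 ∨ w i = 1 := by
  obtain ⟨Z, hZ, hZ1, hZA⟩ := exists_certificate hpoly hdiag hw
  have hZs : ∀ i, Z none (some i) = Z (some i) none := fun i => by
    simpa using hZ.isHermitian.apply (some i) none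
  have hrow : ∀ x ∈ F, ∀ o, (fun j => Z o (some j)) ⬝ᵥ x = -Z o none := by
    intro x hx o
    obtain ⟨X, hX, hX1, hX2, hX3, hX4⟩ := mem_TH.mp (hF hx)
    have hXs : ∀ o p, X p o = X o p := fun o p => by simpa using hX.isHermitian.apply o p
    have htr : (Z * X).trace ≤ 0 := by
      have h1 := hZA _ hX4
      have h2 : ∑ i, (w i + 2 * Z (some i) none) * x i =
          w ⬝ᵥ x + 2 * ∑ i, Z (some i) none * x i := by
        rw [Finset.mul_sum, dotProduct, ← Finset.sum_add_distrib]
        exact Finset.sum_congr rfl fun i _ => by ring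
      simp only [submatrix_apply, hX3, h2, hwF x hx] at h1
      have h4 : ∀ i, X none (some i) = x i := fun i => by rw [hXs, hX2]
      simp only [trace, diag_apply, Matrix.mul_apply, Fintype.sum_option, hZ1, hX1, hZs,
        h4, Finset.sum_add_distrib]
      have h3 : ∑ i, ∑ j, Z (some i) (some j) * X (some j) (some i) =
          ∑ i, ∑ j, Z (some i) (some j) * X (some i) (some j) :=
        Finset.sum_congr rfl fun i _ => Finset.sum_congr rfl fun j _ => by rw [hXs]
      simp only [h3, hX2]
      linarith
    -- Column `none` of the lift is `(1, x)`.
    have h0 := congrFun (congrFun (mul_eq_zero_of_trace_nonpos hZ hX htr) o) none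
    simp only [Matrix.mul_apply, Fintype.sum_option, hX1, hX2, Matrix.zero_apply] at h0
    rw [dotProduct]
    linarith
  have hmul : ∀ o j, Z o (some j) = -Z o none * w j := by
    intro o j
    obtain ⟨r, hr1, hr2⟩ := exists_eq_smul_of_affDim hne hdim hw0 hwF (fun x hx => hrow x hx o)
    rw [hr2, mul_one]
    exact congrFun hr1 j
  have hz : ∀ i, Z (some i) none = -w i := fun i => by
    rw [← hZs, hmul, hZ1]
    ring
  have hV : ∀ i j, Z (some i) (some j) = w i * w j := fun i j => by
    rw [hmul, hz, neg_neg]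
  -- Substituting the rank-one form of `Z` into the certificate.
  have hdual : ∀ X ∈ A, 0 ≤ traceInner X (diagonal w - vecMulVec w w) := by
    intro X hX
    have h1 := hZA X hX
    have h2 : traceInner X (diagonal w - vecMulVec w w) =
        ∑ i, w i * X i i - ∑ i, ∑ j, w i * w j * X i j := by
      rw [traceInner_eq_sum, ← Finset.sum_sub_distrib]
      refine Finset.sum_congr rfl fun i _ => ?_
      simp only [Matrix.sub_apply, vecMulVec_apply, mul_sub, Finset.sum_sub_distrib]
      congr 1
      · rw [Finset.sum_eq_single i]
        · rw [diagonal_apply_eq, mul_comm]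
        · intro j _ hj
          rw [diagonal_apply_ne _ hj.symm, mul_zero]
        · simp
      · exact Finset.sum_congr rfl fun j _ => by ring
    have h3 : ∑ i, (w i + 2 * Z (some i) none) * X i i = -∑ i, w i * X i i := by
      rw [← Finset.sum_neg_distrib]
      exact Finset.sum_congr rfl fun i _ => by rw [hz]; ring
    simp only [h3, hV] at h1
    linarith
  have hsq : ∀ i, w i * w i = w i := fun i => by
    have := diag_eq_zero_of_forall_nonneg hdiag hdual i
    simp only [Matrix.sub_apply, diagonal_apply_eq, vecMulVec_apply] at this
    linarith
  refine ⟨outer_mem_TH hsq ⟨w, diagonal w - vecMulVec w w, ⟨?_, hdual⟩, by simp⟩, fun i => ?_⟩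
  · exact (isSymm_diagonal w).sub (by ext i j; simp [vecMulVec_apply, mul_comm])
  · rcases mul_eq_zero.mp (show w i * (w i - 1) = 0 by rw [mul_sub, hsq]; ring) with h | h
    · exact .inl h
    · exact .inr (by linarith)

theorem isDeterminedBy_smul [Fintype V] {C : Set (V → ℝ)} {c : V → ℝ} (hc : c ≠ 0) {r : ℝ}
    (hr : 0 < r) {x : V → ℝ} (hx : x ∈ argmax C c) :
    IsDeterminedBy C (argmax C c) (r • c) (r * c ⬝ᵥ x) := by
  refine ⟨smul_ne_zero hr.ne' hc, ⟨?_, ?_⟩, ?_⟩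
  · rintro _ ⟨y, hy, rfl⟩
    rw [smul_dotProduct, smul_eq_mul]
    exact mul_le_mul_of_nonneg_left (hx.2 y hy) hr.le
  · intro b hb
    exact hb ⟨x, hx.1, by rw [smul_dotProduct, smul_eq_mul]⟩
  · ext y
    simp only [argmax, Set.mem_ofPred_eq, smul_dotProduct, smul_eq_mul, mul_le_mul_iff_right₀ hr]

end ThetaBody

/-- The inequality `x i ≥ 0` is written in the form `⟨-eᵢ, x⟩ ≤ 0`. -/
theorem mainTheorem11 {V : Type*} [Fintype V] [DecidableEq V] (A : Set (Matrix V V ℝ))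
    (hpoly : ThetaBody.IsPolyhedralSymCone A)
    (hscal : ThetaBody.IsDiagScalingInvariant A)
    (hdiag : Set.range (Matrix.diagonal : (V → ℝ) → Matrix V V ℝ) ⊆ A)
    (F : Set (V → ℝ))
    (hF : ThetaBody.IsFacet (ThetaBody.TH A (ThetaBody.psdCone (Option V))) F) :
    (∃ i : V, ThetaBody.IsDeterminedBy
      (ThetaBody.TH A (ThetaBody.psdCone (Option V))) F (-Pi.single i 1) 0) ∨
    (∃ w ∈ ThetaBody.TH (ThetaBody.adjDual A) (ThetaBody.psdCone (Option V)),
      (∀ i, w i = 0 ∨ w i = 1) ∧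
      ThetaBody.IsDeterminedBy
        (ThetaBody.TH A (ThetaBody.psdCone (Option V))) F w 1) := by
  open ThetaBody in
  obtain ⟨-, hFC, hdim, c, hc, rfl⟩ := hF
  have hdiag' : ∀ u, Matrix.diagonal u ∈ A := fun u => hdiag ⟨u, rfl⟩
  rw [affDim_TH hdiag'] at hdim
  obtain ⟨k, hk⟩ := Function.ne_iff.mp hc
  have hne : (argmax (TH A (psdCone (Option V))) c).Nonempty := by
    by_contra hemp
    -- The empty set has dimension `-1`, which would force `V` to be empty.
    have := Fintype.card_pos_iff.mpr ⟨k⟩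
    rw [affDim, if_neg hemp] at hdim
    omega
  obtain ⟨p, hp⟩ := hne
  have hval : ∀ x ∈ argmax (TH A (psdCone (Option V))) c, c ⬝ᵥ x = c ⬝ᵥ p := fun x hx =>
    le_antisymm (hp.2 x hx.1) (hx.2 p hp.1)
  by_cases hneg : ∃ i, c i < 0
  · obtain ⟨i, hi⟩ := hneg
    left
    have hzero : ∀ x ∈ argmax (TH A (psdCone (Option V))) c, (Pi.single i 1 : V → ℝ) ⬝ᵥ x = 0 := by
      intro x hx
      rw [single_one_dotProduct]
      -- Zeroing coordinate `i` changes the objective by `-c i * x i ≥ 0`, so optimality forces `x i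
      -- = 0`.
      have h1 := hx.2 _ (update_zero_mem_TH hscal hx.1 i)
      have h2 : Function.update x i 0 = x - Pi.single i (x i) := by
        ext j
        rcases eq_or_ne j i with rfl | hj <;> simp [*]
      rw [h2, dotProduct_sub, dotProduct_single] at h1
      have h3 := nonneg_of_mem_TH hx.1 i
      nlinarith
    obtain ⟨r, hr1, hr2⟩ := exists_eq_smul_of_affDim ⟨p, hp⟩ hdim hc hval hzero
    have hri : 1 = r * c i := by simpa using congrFun hr1 i
    have hr : 0 < -r := by nlinarith
    have := isDeterminedBy_smul hc hr hp
    rw [neg_smul, ← hr1, neg_mul, ← hr2, neg_zero] at this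
    exact ⟨i, this⟩
  · push Not at hneg
    right
    -- The unit vector at `k` already attains `c k > 0`.
    have hβ : 0 < c ⬝ᵥ p := by
      have := hp.2 _ (single_mem_TH hdiag' k)
      rw [dotProduct_single_one] at this
      exact ((hneg k).lt_of_ne' hk).trans_le this
    have hdet := isDeterminedBy_smul hc (inv_pos.mpr hβ) hp
    rw [inv_mul_cancel₀ hβ.ne'] at hdet
    obtain ⟨hmem, h01⟩ := mem_TH_adjDual_of_facet hpoly hdiag' hdet.1
      (fun x hx => hdet.2.1.1 ⟨x, hx, rfl⟩) ⟨p, hp⟩ hdim hFC (fun x hx => by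
        rw [smul_dotProduct, smul_eq_mul, hval x hx, inv_mul_cancel₀ hβ.ne'])
    exact ⟨_, hmem, h01, hdet⟩
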